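/- For $n\ge 1$ let $VB_n$ be the virtual braid group on $n$ strands, i.e. the group with generators $\sigma_1,\dots,\sigma_{n-1},\rho_1,\dots,\rho_{n-1}$ and defining relations $$\sigma_i\sigma_j=\sigma_j\sigma_i,\quad \rho_i\rho_j=\rho_j\rho_i,\quad \sigma_i\rho_j=\rho_j\sigma_i \qquad (|i-j|\ge 2),$$ $$\sigma_i\sigma_{i+1}\sigma_i=\sigma_{i+1}\sigma_i\sigma_{i+1},\quad \rho_i\rho_{i+1}\rho_i=\rho_{i+1}\rho_i\rho_{i+1},\quad \rho_i\rho_{i+1}\sigma_i=\sigma_{i+1}\rho_i\rho_{i+1}\qquad (1\le i\le n-2),$$ $$\rho_i^2=1\qquad (1\le i\le n-1).$$ Let $VB_n'=[VB_n,VB_n]$ be its commutator subgroup and $VB_n''=[VB_n',VB_n']$. Write $\mathbb{Z}_3=\mathbb{Z}/3\mathbb{Z}$, and let $\mathbb{Z}^{\infty}$ be the direct sum of countably infinitely many copies of $\mathbb{Z}$. Then: 1. $VB_3'/VB_3''\cong \mathbb{Z}_3\oplus\mathbb{Z}_3\oplus\mathbb{Z}_3\oplus\mathbb{Z}^{\infty}$.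 2. $VB_4'/VB_4''\cong \mathbb{Z}_3\oplus\mathbb{Z}_3\oplus\mathbb{Z}_3$. 3. For every $n\ge 5$, the group $VB_n'$ is perfect, that is, $VB_n'=VB_n''$. -/

import Mathlib

namespace VirtualBraid

/-- The generators `σ_i` and `ρ_i` of the virtual braid group on `n` strands. The usual indices
`1, …, n - 1` are shifted to `0, …, n - 2`. -/
inductive Gen (n : ℕ) : Type
  | sigma (i : Fin (n - 1)) : Gen n
  | rho (i : Fin (n - 1)) : Gen n

/-- `σ_i` in the free group on the generators. -/
def fs {n : ℕ} (i : Fin (n - 1)) : FreeGroup (Gen n) := FreeGroup.of (Gen.sigma i)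

/-- `ρ_i` in the free group on the generators. -/
def fr {n : ℕ} (i : Fin (n - 1)) : FreeGroup (Gen n) := FreeGroup.of (Gen.rho i)

/-- `|i - j| ≥ 2`. -/
def Far {m : ℕ} (i j : Fin m) : Prop := (i : ℕ) + 2 ≤ (j : ℕ) ∨ (j : ℕ) + 2 ≤ (i : ℕ)

/-- The defining relators of the virtual braid group; a relation `u = v` is the relator
`u * v⁻¹`. In the braid-type relations, `j` is the successor of `i`. -/
inductive Rel (n : ℕ) : FreeGroup (Gen n) → Prop
  /-- `σ_i σ_j = σ_j σ_i` for `|i - j| ≥ 2` -/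
  | sigma_comm (i j : Fin (n - 1)) (h : Far i j) :
      Rel n ((fs i * fs j) * (fs j * fs i)⁻¹)
  /-- `σ_i σ_{i+1} σ_i = σ_{i+1} σ_i σ_{i+1}` -/
  | sigma_braid (i j : Fin (n - 1)) (h : (j : ℕ) = (i : ℕ) + 1) :
      Rel n ((fs i * fs j * fs i) * (fs j * fs i * fs j)⁻¹)
  /-- `ρ_i ^ 2 = 1` -/
  | rho_sq (i : Fin (n - 1)) : Rel n (fr i ^ 2)
  /-- `ρ_i ρ_j = ρ_j ρ_i` for `|i - j| ≥ 2` -/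
  | rho_comm (i j : Fin (n - 1)) (h : Far i j) :
      Rel n ((fr i * fr j) * (fr j * fr i)⁻¹)
  /-- `ρ_i ρ_{i+1} ρ_i = ρ_{i+1} ρ_i ρ_{i+1}` -/
  | rho_braid (i j : Fin (n - 1)) (h : (j : ℕ) = (i : ℕ) + 1) :
      Rel n ((fr i * fr j * fr i) * (fr j * fr i * fr j)⁻¹)
  /-- `σ_i ρ_j = ρ_j σ_i` for `|i - j| ≥ 2` -/
  | mixed_comm (i j : Fin (n - 1)) (h : Far i j) :
      Rel n ((fs i * fr j) * (fr j * fs i)⁻¹)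
  /-- `ρ_i ρ_{i+1} σ_i = σ_{i+1} ρ_i ρ_{i+1}` -/
  | mixed_braid (i j : Fin (n - 1)) (h : (j : ℕ) = (i : ℕ) + 1) :
      Rel n ((fr i * fr j * fs i) * (fs j * fr i * fr j)⁻¹)

/-- The virtual braid group `VB_n` on `n` strands, by its defining presentation. -/
abbrev VB (n : ℕ) : Type := PresentedGroup {r : FreeGroup (Gen n) | Rel n r}

end VirtualBraid

/-!
Write `s = σ₁`, `r = ρ₁` and `c = ρ₁ρ₂`. The mixed relation gives `σ₂ = c s c⁻¹`, so `VB₃` is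
generated by `s`, `r`, `c` with the relations `r² = c³ = 1`, `r c r = c⁻¹` and the braid relation
between `s` and `c s c⁻¹` (`Triple`).

*Upper bound.* The group `G' / G''` is abelian, and `G` acts on it by conjugation through `G / G'`,
so that conjugations commute. Let `t` be conjugation by `s`, and let `δ`, `υ` be the classes of `c`
and `[s, r]`. Then `r` acts as `-1`, `3δ = 0`, the braid relation becomes `(t³ + t² - t - 1) δ = 0`
(`Triple.recurrence`), and `δ`, `υ` generate `G' / G''` under the powers of `t` (`Triple.eq_top`).
This gives a surjection from `𝔽₃[t] / (t³ + t² - t - 1) × ℤ[t, t⁻¹]` onto `G' / G''`.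

*Lower bound.* On that same group `D` let `s`, `r`, `c` act by `m ↦ t m + w`, `m ↦ -m` and `m ↦ m +
d`, where `d` and `w` generate the two factors. The relations hold (`affine_triple`), commutators
act by translations (`apply_of_mem_commutator`), and the translation part sends `δ` to `d` and `υ`
to `2 w`, which makes the surjection injective (`nonempty_equiv_cubic_prod`).

For four strands, `ρ₁` and `ρ₃` agree modulo `G''`, because `[A₄, A₄]` contains `(1 2)(3 4)`
(`mk_ρ_eq`). Since `σ₁` commutes with `ρ₃`, the class `υ` vanishes, and only the finite factor is
left (`nonempty_equiv_cubic`, with `w = 0`). For five or more strands all `ρ_i` agree modulo `G''`,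
so one of the `ρ_i` that commutes with `σ₁` shows that `G / G''` is abelian
(`commutator_le_derived₂`).
-/

namespace VirtualBraid

open scoped commutatorElement

/-! ### The action of a group on `G' / G''` -/

section Metabelian

variable {G : Type*} [Group G]

lemma mem_commutator_iff {x : G} : x ∈ commutator G ↔ Abelianization.of x = 1 := by
  rw [← MonoidHom.mem_ker, Abelianization.ker_of]

/-- A subgroup that is normalized by a generating set and contains the commutators of the generators
contains the commutator subgroup. -/
theorem commutator_le_of_closure_eq_top {S : Set G} (hS : Subgroup.closure S = ⊤)
    (H : Subgroup G) (hconj : ∀ x ∈ S, ∀ h ∈ H, x * h * x⁻¹ ∈ H ∧ x⁻¹ * h * x ∈ H)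
    (hcomm : ∀ x ∈ S, ∀ y ∈ S, ⁅x, y⁆ ∈ H) : commutator G ≤ H := by
  have hN : H.Normal := by
    rw [← Subgroup.normalizer_eq_top_iff, eq_top_iff, ← hS, Subgroup.closure_le]
    intro x hx
    rw [SetLike.mem_coe, Subgroup.mem_normalizer_iff]
    refine fun h => ⟨fun hh => (hconj x hx h hh).1, fun hh => ?_⟩
    simpa [mul_assoc] using (hconj x hx _ hh).2
  have key : ∀ x ∈ S, ∀ y : G, ⁅x, y⁆ ∈ H := by
    intro x hx y
    have : (⊤ : Subgroup G) ≤ (Subgroup.centralizer {(x : G ⧸ H)}).comap (QuotientGroup.mk' H) := by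
      rw [← hS, Subgroup.closure_le]
      intro y hy
      have := (QuotientGroup.eq_one_iff _).2 (hcomm x hx y hy)
      rw [← QuotientGroup.mk'_apply, map_commutatorElement,
        commutatorElement_eq_one_iff_mul_comm] at this
      simpa [Subgroup.mem_centralizer_singleton_iff] using this.symm
    have := this (Subgroup.mem_top y)
    rw [← QuotientGroup.eq_one_iff, ← QuotientGroup.mk'_apply, map_commutatorElement,
        commutatorElement_eq_one_iff_mul_comm]
    exact this _ rfl
  rw [commutator_def, Subgroup.commutator_le]
  intro x _ y _
  have : (⊤ : Subgroup G) ≤ (Subgroup.centralizer {(y : G ⧸ H)}).comap (QuotientGroup.mk' H) := by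
    rw [← hS, Subgroup.closure_le]
    intro x hx
    have := (QuotientGroup.eq_one_iff _).2 (key x hx y)
    rw [← QuotientGroup.mk'_apply, map_commutatorElement,
      commutatorElement_eq_one_iff_mul_comm] at this
    simpa [Subgroup.mem_centralizer_singleton_iff] using this
  have := this (Subgroup.mem_top x)
  rw [← QuotientGroup.eq_one_iff, ← QuotientGroup.mk'_apply, map_commutatorElement,
      commutatorElement_eq_one_iff_mul_comm]
  simpa [Subgroup.mem_centralizer_singleton_iff] using this

variable (G) in
/-- The second derived subgroup `G''`. -/
abbrev derived₂ : Subgroup G := ⁅commutator G, commutator G⁆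

variable (G) in
/-- The abelian group `G' / G''`, written additively. -/
abbrev DerivedQuot : Type _ := Additive (Abelianization (commutator G))

/-- The class in `G' / G''` of an element of `G'`. -/
def cls (x : G) (hx : x ∈ commutator G) : DerivedQuot G :=
  Additive.ofMul (Abelianization.of ⟨x, hx⟩)

/-- The action of `g` on `G' / G''` by conjugation, `x ↦ g * x * g⁻¹`. -/
def conjAct (g : G) : DerivedQuot G →+ DerivedQuot G :=
  MonoidHom.toAdditive
    (Abelianization.map (MulAut.conjNormal (H := commutator G) g).toMonoidHom)

lemma exists_cls (b : DerivedQuot G) : ∃ x hx, cls (G := G) x hx = b := by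
  obtain ⟨⟨x, hx⟩, h⟩ := QuotientGroup.mk_surjective (Additive.toMul b)
  exact ⟨x, hx, h⟩

lemma cls_mul {x y : G} (hx : x ∈ commutator G) (hy : y ∈ commutator G) :
    cls (x * y) (mul_mem hx hy) = cls x hx + cls y hy := rfl

lemma cls_one : cls (1 : G) (one_mem _) = 0 := rfl

lemma cls_inv {x : G} (hx : x ∈ commutator G) : cls x⁻¹ (inv_mem hx) = -cls x hx := rfl

lemma cls_congr {x y : G} (h : x = y) (hx : x ∈ commutator G) :
    cls x hx = cls y (h ▸ hx) := by subst h; rfl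

lemma cls_eq_zero {x : G} (hx : x ∈ commutator G) :
    cls x hx = 0 ↔ x ∈ derived₂ G := by
  have : cls x hx = 0 ↔ (⟨x, hx⟩ : commutator G) ∈ commutator (commutator G) :=
    mem_commutator_iff.symm
  rw [this, derived₂, ← Subgroup.map_subtype_commutator, Subgroup.mem_map]
  constructor
  · exact fun h => ⟨_, h, rfl⟩
  · rintro ⟨y, hy, rfl⟩
    exact hy

lemma conj_mem_commutator (g : G) {x : G} (hx : x ∈ commutator G) :
    g * x * g⁻¹ ∈ commutator G := Subgroup.Normal.conj_mem inferInstance _ hx g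

lemma conjAct_cls (g : G) {x : G} (hx : x ∈ commutator G) :
    conjAct g (cls x hx) = cls (g * x * g⁻¹) (conj_mem_commutator g hx) := rfl

lemma conjAct_mul (g h : G) (b : DerivedQuot G) :
    conjAct (g * h) b = conjAct g (conjAct h b) := by
  obtain ⟨x, hx, rfl⟩ := exists_cls b
  simp only [conjAct_cls]
  exact cls_congr (by group) _

lemma conjAct_one (b : DerivedQuot G) : conjAct 1 b = b := by
  obtain ⟨x, hx, rfl⟩ := exists_cls b
  rw [conjAct_cls]
  exact cls_congr (by group) _

lemma conjAct_of_mem {g : G} (hg : g ∈ commutator G) (b : DerivedQuot G) : conjAct g b = b := by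
  obtain ⟨x, hx, rfl⟩ := exists_cls b
  have : cls (g * x * g⁻¹) (conj_mem_commutator g hx) = cls g hg + cls x hx - cls g hg := by
    rw [sub_eq_add_neg, ← cls_inv, ← cls_mul, ← cls_mul]
  rw [conjAct_cls, this, add_sub_cancel_left]

lemma conjAct_comm (g h : G) (b : DerivedQuot G) :
    conjAct g (conjAct h b) = conjAct h (conjAct g b) := by
  have hm : ⁅g, h⁆ ∈ commutator G :=
    Subgroup.commutator_mem_commutator (Subgroup.mem_top _) (Subgroup.mem_top _)
  rw [← conjAct_mul, ← conjAct_mul, ← conjAct_of_mem hm (conjAct (h * g) b), ← conjAct_mul]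
  congr 2
  rw [commutatorElement_def]; group

lemma conjAct_inv_self (g : G) (b : DerivedQuot G) : conjAct g⁻¹ (conjAct g b) = b := by
  rw [← conjAct_mul, inv_mul_cancel, conjAct_one]

end Metabelian

/-! ### Generators of `G' / G''` -/

/-- Elements `s`, `r`, `c` that satisfy the relations of `σ₁`, `ρ₁` and `ρ₁ρ₂` in the virtual braid
group, where `σ₂ = c * s * c⁻¹`, so that the last relation is the braid relation of `σ₁` and
`σ₂`. -/
structure Triple {P : Type*} [Group P] (s r c : P) : Prop where
  r_sq : r * r = 1
  c_cube : c * c * c = 1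
  rcr : r * c * r = c⁻¹
  braid : s * (c * s * c⁻¹) * s = (c * s * c⁻¹) * s * (c * s * c⁻¹)

namespace Triple

variable {G : Type*} [Group G] {s r c : G} (T : Triple s r c)
include T

lemma c_mem : c ∈ commutator G := by
  rw [mem_commutator_iff]
  have h1 := congrArg Abelianization.of T.r_sq
  have h2 := congrArg Abelianization.of T.c_cube
  have h3 := congrArg Abelianization.of T.rcr
  simp only [map_mul, map_one, map_inv] at h1 h2 h3
  rw [mul_right_comm, h1, one_mul] at h3
  have h4 : Abelianization.of c * Abelianization.of c = 1 := by
    nth_rewrite 2 [h3]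
    exact mul_inv_cancel _
  rwa [h4, one_mul] at h2

lemma u_mem : s * r * s⁻¹ * r ∈ commutator G := by
  rw [mem_commutator_iff]
  have h1 := congrArg Abelianization.of T.r_sq
  simp only [map_mul, map_one, map_inv] at h1 ⊢
  rw [mul_right_comm _ _ (Abelianization.of r), mul_assoc (Abelianization.of s), h1]
  simp

/-- The class of `ρ₁ρ₂`. -/
def δ : DerivedQuot G := cls c T.c_mem

/-- The class of `[σ₁, ρ₁]`. -/
def υ : DerivedQuot G := cls (s * r * s⁻¹ * r) T.u_mem

/-- `ρ₁ρ₂` has order `3`. -/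
lemma three_δ : T.δ + T.δ + T.δ = 0 := by
  rw [δ, ← cls_mul, ← cls_mul, cls_congr T.c_cube, cls_one]

lemma r_inv : r⁻¹ = r := inv_eq_of_mul_eq_one_left T.r_sq

lemma conjAct_r_δ : conjAct r T.δ = -T.δ := by
  rw [δ, conjAct_cls, ← cls_inv]
  exact cls_congr (by rw [T.r_inv, T.rcr]) _

lemma conjAct_r_υ : conjAct r T.υ = -T.υ := by
  rw [υ, conjAct_cls, ← cls_inv]
  refine cls_congr ?_ _
  simp only [mul_inv_rev, T.r_inv, inv_inv, mul_assoc, T.r_sq, mul_one]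

/-- The braid relation, read in `G' / G''`. With `dᵢ = sⁱ c s⁻ⁱ` it says
`d₁ - d₂ = d₀ - d₁ + d₂ - d₃`; the coefficients are then reduced modulo `3`. -/
lemma recurrence :
    conjAct s (conjAct s (conjAct s T.δ)) =
      T.δ + conjAct s T.δ - conjAct s (conjAct s T.δ) := by
  have h : conjAct s T.δ - conjAct s (conjAct s T.δ) =
      T.δ - conjAct s T.δ + conjAct s (conjAct s T.δ) - conjAct s (conjAct s (conjAct s T.δ)) := by
    simp only [δ, conjAct_cls, sub_eq_add_neg, ← cls_inv, ← cls_mul]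
    refine cls_congr ?_ _
    have := congrArg (· * (s⁻¹ * s⁻¹ * s⁻¹)) T.braid
    simpa [mul_assoc] using this
  have h3 := congrArg (conjAct s) T.three_δ
  have h4 := congrArg (conjAct s) h3
  simp only [map_add, map_zero] at h3 h4
  rw [← sub_eq_zero] at h ⊢
  rw [← h, ← sub_eq_zero]
  abel_nf
  abel_nf at h3 h4
  simp [h3, h4]

/-- A subgroup of `G' / G''` is everything as soon as it contains `δ` and `υ` and is stable under
conjugation by `s^±1` and `r`, provided that `s`, `r`, `c` generate `G` modulo `G''`. -/
theorem eq_top (hS : Subgroup.closure ({s, r, c} ∪ (derived₂ G : Set G)) = ⊤)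
    (S : AddSubgroup (DerivedQuot G)) (hδ : T.δ ∈ S) (hυ : T.υ ∈ S)
    (hs : ∀ b ∈ S, conjAct s b ∈ S) (hs' : ∀ b ∈ S, conjAct s⁻¹ b ∈ S)
    (hr : ∀ b ∈ S, conjAct r b ∈ S) : S = ⊤ := by
  let H : Subgroup G :=
    { carrier := {g | ∃ h, cls g h ∈ S}
      one_mem' := ⟨one_mem _, S.zero_mem⟩
      mul_mem' := fun ⟨hx, hx'⟩ ⟨hy, hy'⟩ => ⟨mul_mem hx hy, S.add_mem hx' hy'⟩
      inv_mem' := fun ⟨hx, hx'⟩ => ⟨inv_mem hx, S.neg_mem hx'⟩ }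
  have hconj : ∀ g, (∀ b ∈ S, conjAct g b ∈ S) → ∀ h ∈ H, g * h * g⁻¹ ∈ H :=
    fun g hg h ⟨hh, hh'⟩ => ⟨conj_mem_commutator g hh, hg _ hh'⟩
  have hconj' : ∀ g, (∀ b ∈ S, conjAct g⁻¹ b ∈ S) → ∀ h ∈ H, g⁻¹ * h * g ∈ H := by
    intro g hg h hh
    simpa using hconj g⁻¹ hg h hh
  have htriv : ∀ g ∈ commutator G, ∀ b ∈ S, conjAct g b ∈ S :=
    fun g hg b hb => by rwa [conjAct_of_mem hg]
  have hG'' : derived₂ G ≤ H := fun x hx =>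
    ⟨Subgroup.commutator_le_self _ hx, by
      rw [(cls_eq_zero (Subgroup.commutator_le_self _ hx)).2 hx]; exact S.zero_mem⟩
  have hc : c ∈ H := ⟨T.c_mem, hδ⟩
  have hu : s * r * s⁻¹ * r ∈ H := ⟨T.u_mem, hυ⟩
  have hr' : ∀ b ∈ S, conjAct r⁻¹ b ∈ S := by rwa [T.r_inv]
  have hN : ∀ x ∈ ({s, r, c} ∪ (derived₂ G : Set G)),
      ∀ h ∈ H, x * h * x⁻¹ ∈ H ∧ x⁻¹ * h * x ∈ H := by
    have hmem : ∀ x ∈ commutator G, ∀ h ∈ H, x * h * x⁻¹ ∈ H ∧ x⁻¹ * h * x ∈ H :=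
      fun x hx h hh => ⟨hconj x (htriv x hx) h hh, hconj' x (htriv _ (inv_mem hx)) h hh⟩
    rintro x ((rfl | rfl | rfl) | hx) h hh
    · exact ⟨hconj _ hs h hh, hconj' _ hs' h hh⟩
    · exact ⟨hconj _ hr h hh, hconj' _ hr' h hh⟩
    · exact hmem _ T.c_mem h hh
    · exact hmem _ (Subgroup.commutator_le_self _ hx) h hh
  have hle : commutator G ≤ H := by
    refine commutator_le_of_closure_eq_top hS H hN ?_
    -- a commutator with an element of `H` lies in `H`, as the generators normalize `H`
    have hleft : ∀ x ∈ H, ∀ y ∈ ({s, r, c} ∪ (derived₂ G : Set G)),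
        ⁅x, y⁆ ∈ H := fun x hx y hy => by
      rw [commutatorElement_def, mul_assoc x y, mul_assoc x]
      exact mul_mem hx (hN y hy _ (inv_mem hx)).1
    have hright : ∀ x ∈ H, ∀ y ∈ ({s, r, c} ∪ (derived₂ G : Set G)),
        ⁅y, x⁆ ∈ H := fun x hx y hy => by
      rw [← commutatorElement_inv]
      exact inv_mem (hleft x hx y hy)
    have hsr : ⁅s, r⁆ ∈ H := by rwa [commutatorElement_def, T.r_inv]
    rintro x hx y hy
    rcases id hy with (rfl | rfl | rfl) | hy'
    · rcases hx with (rfl | rfl | rfl) | hx'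
      · rw [commutatorElement_self]; exact one_mem _
      · rw [← commutatorElement_inv]; exact inv_mem hsr
      · exact hleft _ hc _ hy
      · exact hleft _ (hG'' hx') _ hy
    · rcases hx with (rfl | rfl | rfl) | hx'
      · exact hsr
      · rw [commutatorElement_self]; exact one_mem _
      · exact hleft _ hc _ hy
      · exact hleft _ (hG'' hx') _ hy
    · exact hright _ hc _ hx
    · exact hright _ (hG'' hy') _ hx
  rw [eq_top_iff]
  intro b _
  obtain ⟨x, hx, rfl⟩ := exists_cls b
  exact (hle hx).2

/-- `r` acts as `-1` on `G' / G''`: the elements it negates form a subgroup to which `eq_top`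
applies, because conjugations commute on `G' / G''`. -/
lemma conjAct_r (hS : Subgroup.closure ({s, r, c} ∪ (derived₂ G : Set G)) = ⊤)
    (b : DerivedQuot G) : conjAct r b = -b := by
  have := T.eq_top hS ((conjAct r).eqLocus (-AddMonoidHom.id _)) T.conjAct_r_δ T.conjAct_r_υ
    (fun b hb => ?_) (fun b hb => ?_) (fun b hb => ?_)
  · exact (this ▸ AddSubgroup.mem_top b : b ∈ (conjAct r).eqLocus (-AddMonoidHom.id _))
  all_goals
    change conjAct _ b = -b at hb
    change conjAct _ (conjAct _ b) = - conjAct _ b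
    rw [conjAct_comm, ← map_neg, hb]

end Triple

/-! ### The model for `G' / G''` and its map onto `G' / G''` -/

lemma zmod_three_hom_ext {B : Type*} [AddCommGroup B] {f g : ZMod 3 →+ B} (h : f 1 = g 1) :
    f = g := by
  ext a
  have : a = a.val • (1 : ZMod 3) := by simp
  rw [this, map_nsmul, map_nsmul, h]

/-- The homomorphism `ℤ/3 → B` with value `x` at `1`. -/
def zmodThreeHom {B : Type*} [AddCommGroup B] (x : B) (hx : x + x + x = 0) : ZMod 3 →+ B :=
  ZMod.lift 3 ⟨zmultiplesHom B x, by
    rw [zmultiplesHom_apply]; rw [← hx]; simp only [Nat.cast_ofNat]; abel⟩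

lemma zmodThreeHom_one {B : Type*} [AddCommGroup B] (x : B) (hx : x + x + x = 0) :
    zmodThreeHom x hx 1 = x := by
  have := ZMod.lift_coe 3 ⟨zmultiplesHom B x, by
    rw [zmultiplesHom_apply]; rw [← hx]; simp only [Nat.cast_ofNat]; abel⟩ 1
  rw [Int.cast_one] at this
  exact this.trans (one_zsmul x)

/-- The additive group of `𝔽₃[t] / (t³ + t² - t - 1)`, in the basis `1, t, t²`. -/
abbrev Cubic : Type := ZMod 3 × ZMod 3 × ZMod 3

/-- Multiplication by `t` on `𝔽₃[t] / (t³ + t² - t - 1)`. -/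
def mulT : Cubic ≃+ Cubic where
  toFun x := (x.2.2, x.1 + x.2.2, x.2.1 - x.2.2)
  invFun x := (x.2.1 - x.1, x.2.2 + x.1, x.1)
  left_inv x := by ext <;> simp
  right_inv x := by ext <;> simp
  map_add' x y := by ext <;> simp <;> abel

namespace Triple

section UpperBound

variable {G : Type*} [Group G] {s r c : G} (T : Triple s r c)

lemma three_conjAct_δ (g : G) :
    conjAct g T.δ + conjAct g T.δ + conjAct g T.δ = 0 := by
  rw [← map_add, ← map_add, T.three_δ, map_zero]

/-- The homomorphism `tⁱ ↦ sⁱ δ s⁻ⁱ`. -/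
def ofCubic : Cubic →+ DerivedQuot G :=
  (zmodThreeHom T.δ T.three_δ).coprod
    ((zmodThreeHom (conjAct s T.δ) (T.three_conjAct_δ s)).coprod
      (zmodThreeHom (conjAct s (conjAct s T.δ))
        (by rw [← conjAct_mul]; exact T.three_conjAct_δ _)))

lemma ofCubic_one : T.ofCubic (1, 0, 0) = T.δ := by
  simp [ofCubic, zmodThreeHom_one]

/-- Multiplication by `t` corresponds to conjugation by `s`, by `recurrence`. -/
lemma ofCubic_mulT (x : Cubic) : T.ofCubic (mulT x) = conjAct s (T.ofCubic x) := by
  have h0 : (conjAct s).comp (zmodThreeHom T.δ T.three_δ) =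
      zmodThreeHom (conjAct s T.δ) (T.three_conjAct_δ s) :=
    zmod_three_hom_ext (by simp [zmodThreeHom_one])
  have h1 : (conjAct s).comp (zmodThreeHom (conjAct s T.δ) (T.three_conjAct_δ s)) =
      zmodThreeHom (conjAct s (conjAct s T.δ))
        (by rw [← conjAct_mul]; exact T.three_conjAct_δ _) :=
    zmod_three_hom_ext (by simp [zmodThreeHom_one])
  have h2 : (conjAct s).comp (zmodThreeHom (conjAct s (conjAct s T.δ))
        (by rw [← conjAct_mul]; exact T.three_conjAct_δ _)) =
      zmodThreeHom T.δ T.three_δ + zmodThreeHom (conjAct s T.δ) (T.three_conjAct_δ s) -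
        zmodThreeHom (conjAct s (conjAct s T.δ))
          (by rw [← conjAct_mul]; exact T.three_conjAct_δ _) :=
    zmod_three_hom_ext (by simp [zmodThreeHom_one, T.recurrence])
  obtain ⟨a, b, e⟩ := x
  have h0 := DFunLike.congr_fun h0 a
  have h1 := DFunLike.congr_fun h1 b
  have h2 := DFunLike.congr_fun h2 e
  simp only [AddMonoidHom.comp_apply, AddMonoidHom.sub_apply, AddMonoidHom.add_apply] at h0 h1 h2
  simp only [ofCubic, mulT, AddEquiv.coe_mk, Equiv.coe_fn_mk, AddMonoidHom.coprod_apply, map_add,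
    map_sub, h0, h1, h2]
  abel

/-- The image of a homomorphism to `G' / G''` that carries an automorphism to conjugation by `s` is
stable under `s` and `s⁻¹`, and under `r` because `r` acts as `-1`. -/
theorem surjective_of_equivariant
    (hS : Subgroup.closure ({s, r, c} ∪ (derived₂ G : Set G)) = ⊤)
    {F : Type*} [AddCommGroup F] (t : F ≃+ F) (ψ : F →+ DerivedQuot G)
    (hψ : ∀ x, ψ (t x) = conjAct s (ψ x)) (hδ : T.δ ∈ ψ.range) (hυ : T.υ ∈ ψ.range) :
    Function.Surjective ψ := by
  rw [← AddMonoidHom.range_eq_top]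
  refine T.eq_top hS _ hδ hυ ?_ ?_ ?_
  · rintro _ ⟨x, rfl⟩
    exact ⟨t x, hψ x⟩
  · rintro _ ⟨x, rfl⟩
    refine ⟨t.symm x, ?_⟩
    rw [← conjAct_inv_self s (ψ (t.symm x)), ← hψ, t.apply_symm_apply]
  · rintro _ ⟨x, rfl⟩
    rw [T.conjAct_r hS]
    exact neg_mem ⟨x, rfl⟩

/-- The homomorphism from the free abelian group on `ℤ` that sends the `k`-th basis element
to `sᵏ υ s⁻ᵏ`. -/
noncomputable def ofFree : (ℤ →₀ ℤ) →+ DerivedQuot G :=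
  Finsupp.liftAddHom fun k => zmultiplesHom _ (conjAct (s ^ k) T.υ)

lemma ofFree_single (k a : ℤ) : T.ofFree (Finsupp.single k a) = a • conjAct (s ^ k) T.υ := by
  simp [ofFree]

end UpperBound

end Triple

/-- The shift by `1` of the index set of the free abelian group on `ℤ`. -/
noncomputable def shift : (ℤ →₀ ℤ) ≃+ (ℤ →₀ ℤ) := Finsupp.domCongr (Equiv.addRight 1)

lemma shift_single (k a : ℤ) : shift (Finsupp.single k a) = Finsupp.single (k + 1) a := by
  simp [shift]

lemma Triple.ofFree_shift {G : Type*} [Group G] {s r c : G} (T : Triple s r c) (x : ℤ →₀ ℤ) :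
    T.ofFree (shift x) = conjAct s (T.ofFree x) := by
  suffices T.ofFree.comp shift.toAddMonoidHom = (conjAct s).comp T.ofFree from
    DFunLike.congr_fun this x
  refine Finsupp.addHom_ext fun k a => ?_
  change T.ofFree (shift (Finsupp.single k a)) = conjAct s (T.ofFree (Finsupp.single k a))
  rw [shift_single, ofFree_single, ofFree_single, map_zsmul, ← conjAct_mul, add_comm,
    zpow_one_add]

/-! ### Affine permutation representations -/

section Affine

variable {D : Type*} [AddCommGroup D] (t : D ≃+ D) (d w : D)

/-- The affine permutation `m ↦ t m + w`. -/
def affS : Equiv.Perm D := t.toEquiv.trans (Equiv.addRight w)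

/-- The permutation `m ↦ -m`. -/
def affR : Equiv.Perm D := Equiv.neg D

/-- The translation `m ↦ m + d`. -/
def affC : Equiv.Perm D := Equiv.addRight d

lemma affS_apply (m : D) : affS t w m = t m + w := rfl
lemma affR_apply (m : D) : affR m = -m := rfl
lemma affC_apply (m : D) : affC d m = m + d := rfl
lemma affC_inv_apply (m : D) : (affC d)⁻¹ m = m - d := (sub_eq_add_neg m d).symm
lemma affR_inv_apply (m : D) : affR⁻¹ m = -m := rfl
lemma affS_inv_apply (m : D) : (affS t w)⁻¹ m = t.symm (m - w) := by
  rw [sub_eq_add_neg]; rfl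

/-- The two hypotheses on `d` are what the order of `ρ₁ρ₂` and the braid relation require; `t` and
`w` are otherwise arbitrary. -/
lemma affine_triple (h3 : d + d + d = 0) (hd : t (t (t d)) = d + t d - t (t d)) :
    Triple (affS t w) affR (affC d) where
  r_sq := by ext m; simp [affR_apply]
  c_cube := by
    ext m
    simp only [Equiv.Perm.mul_apply, affC_apply, Equiv.Perm.one_apply]
    rw [add_assoc, add_assoc, ← add_assoc d, h3, add_zero]
  rcr := by
    ext m
    simp only [Equiv.Perm.mul_apply, affC_apply, affR_apply, affC_inv_apply]
    abel
  braid := by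
    ext m
    have h3' := congrArg t h3
    have h3'' := congrArg t h3'
    simp only [map_add, map_zero] at h3' h3''
    simp only [Equiv.Perm.mul_apply, affC_apply, affS_apply, affC_inv_apply, map_add, map_sub, hd]
    rw [← sub_eq_zero]
    abel_nf
    abel_nf at h3' h3''
    simp [h3', h3'']

variable {G : Type*} [Group G] (ρ : G →* Equiv.Perm D)

/-- In a group of permutations generated by `m ↦ t m + w`, `m ↦ -m` and `m ↦ m + d`, commutators
are translations. -/
lemma apply_of_mem_commutator
    (hρ : Subgroup.closure {g | ρ g = affS t w ∨ ρ g = affR ∨ ρ g = affC d} = ⊤)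
    {g : G} (hg : g ∈ commutator G) (m : D) : ρ g m = m + ρ g 0 := by
  let H : Subgroup G :=
    { carrier := {g | ∃ v, ∀ m, ρ g m = m + v}
      one_mem' := ⟨0, fun m => by simp⟩
      mul_mem' := fun {x y} ⟨v, hv⟩ ⟨v', hv'⟩ => ⟨v' + v, fun m => by
        rw [map_mul, Equiv.Perm.mul_apply, hv, hv', add_assoc]⟩
      inv_mem' := fun {x} ⟨v, hv⟩ => ⟨-v, fun m => by
        rw [map_inv, Equiv.Perm.inv_eq_iff_eq, hv]; abel⟩ }
  have hle : commutator G ≤ H := by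
    refine commutator_le_of_closure_eq_top hρ H ?_ ?_
    · rintro x (hx | hx | hx) h ⟨v, hv⟩
      · refine ⟨⟨t v, fun m => ?_⟩, ⟨t.symm v, fun m => ?_⟩⟩ <;>
        simp only [map_mul, map_inv, Equiv.Perm.mul_apply, hx, hv, affS_apply, affS_inv_apply,
          map_add, map_sub, AddEquiv.apply_symm_apply, AddEquiv.symm_apply_apply] <;> abel
      · refine ⟨⟨-v, fun m => ?_⟩, ⟨-v, fun m => ?_⟩⟩ <;>
        simp only [map_mul, map_inv, Equiv.Perm.mul_apply, hx, hv, affR_apply, affR_inv_apply] <;>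
        abel
      · refine ⟨⟨v, fun m => ?_⟩, ⟨v, fun m => ?_⟩⟩ <;>
        simp only [map_mul, map_inv, Equiv.Perm.mul_apply, hx, hv, affC_apply, affC_inv_apply] <;>
        abel
    · rintro x (hx | hx | hx) y (hy | hy | hy)
      on_goal 1 => refine ⟨0, fun m => ?_⟩
      on_goal 2 => refine ⟨w + w, fun m => ?_⟩
      on_goal 3 => refine ⟨t d - d, fun m => ?_⟩
      on_goal 4 => refine ⟨-(w + w), fun m => ?_⟩
      on_goal 5 => refine ⟨0, fun m => ?_⟩
      on_goal 6 => refine ⟨-(d + d), fun m => ?_⟩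
      on_goal 7 => refine ⟨d - t d, fun m => ?_⟩
      on_goal 8 => refine ⟨d + d, fun m => ?_⟩
      on_goal 9 => refine ⟨0, fun m => ?_⟩
      all_goals
        simp only [commutatorElement_def, map_mul, map_inv, Equiv.Perm.mul_apply, hx, hy,
          affS_apply, affS_inv_apply, affR_apply, affR_inv_apply, affC_apply, affC_inv_apply,
          map_add, map_sub, map_neg, AddEquiv.apply_symm_apply]
        abel
  obtain ⟨v, hv⟩ := hle hg
  rw [hv m, hv 0, zero_add]

/-- The homomorphism `G' / G'' → D` that sends a commutator, acting as the translation by `v`,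
to `v`. -/
def translationHom
    (hρ : Subgroup.closure {g | ρ g = affS t w ∨ ρ g = affR ∨ ρ g = affC d} = ⊤) :
    DerivedQuot G →+ D :=
  MonoidHom.toAdditiveLeft <| Abelianization.lift
    { toFun := fun g => Multiplicative.ofAdd (ρ g 0)
      map_one' := by simp
      map_mul' := fun g h => by
        rw [← ofAdd_add, Subgroup.coe_mul, map_mul, Equiv.Perm.mul_apply,
          apply_of_mem_commutator t d w ρ hρ g.2, add_comm] }

variable (hρ : Subgroup.closure {g | ρ g = affS t w ∨ ρ g = affR ∨ ρ g = affC d} = ⊤)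

lemma translationHom_cls {x : G} (hx : x ∈ commutator G) :
    translationHom t d w ρ hρ (cls x hx) = ρ x 0 := rfl

lemma translationHom_conjAct {s : G} (hs : ρ s = affS t w) (b : DerivedQuot G) :
    translationHom t d w ρ hρ (conjAct s b) = t (translationHom t d w ρ hρ b) := by
  obtain ⟨x, hx, rfl⟩ := exists_cls b
  rw [conjAct_cls, translationHom_cls, translationHom_cls, map_mul, map_mul, map_inv,
    Equiv.Perm.mul_apply, Equiv.Perm.mul_apply, apply_of_mem_commutator t d w ρ hρ hx, hs,
    affS_inv_apply, affS_apply, map_add, AddEquiv.apply_symm_apply]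
  abel

variable {s r c : G} (T : Triple s r c)

lemma translationHom_δ (hc : ρ c = affC d) : translationHom t d w ρ hρ T.δ = d := by
  rw [Triple.δ, translationHom_cls, hc, affC_apply, zero_add]

lemma translationHom_υ (hs : ρ s = affS t w) (hr : ρ r = affR) :
    translationHom t d w ρ hρ T.υ = w + w := by
  rw [Triple.υ, translationHom_cls]
  simp only [map_mul, map_inv, Equiv.Perm.mul_apply, hs, hr, affS_apply, affS_inv_apply,
    affR_apply, map_sub, map_neg, map_zero, AddEquiv.apply_symm_apply]
  abel

/-- Equivariance under `s`, iterated: a sequence `v` with `v (k + 1) = t (v k)` gives the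
translations of the conjugates of `b` under powers of `s`. -/
lemma translationHom_zpow {s : G} (hs : ρ s = affS t w) (k : ℤ) (b : DerivedQuot G) (v : ℤ → D)
    (hv : ∀ k, v (k + 1) = t (v k)) (hb : translationHom t d w ρ hρ b = v 0) :
    translationHom t d w ρ hρ (conjAct (s ^ k) b) = v k := by
  induction k using Int.induction_on with
  | zero => rw [zpow_zero, conjAct_one, hb]
  | succ k ih =>
    rw [add_comm, zpow_one_add, conjAct_mul, translationHom_conjAct t d w ρ hρ hs, ih, add_comm, hv]
  | pred k ih =>
    apply t.injective
    rw [← hv, ← translationHom_conjAct t d w ρ hρ hs, ← conjAct_mul, ← zpow_one_add]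
    simpa using ih

end Affine

/-! ### Determination of `G' / G''` from a triple and an affine action -/

section Models

lemma prodCongr_apply (x : Cubic) (y : ℤ →₀ ℤ) :
    mulT.prodCongr shift (x, y) = (mulT x, shift y) := rfl

variable {G : Type*} [Group G] {s r c : G} (T : Triple s r c)
  (hS : Subgroup.closure ({s, r, c} ∪ (derived₂ G : Set G)) = ⊤)

lemma cubic_hom_ext {B : Type*} [AddCommGroup B] {f g : Cubic →+ B} (h : f (1, 0, 0) = g (1, 0, 0))
    (hT : f (mulT (1, 0, 0)) = g (mulT (1, 0, 0)))
    (hT2 : f (mulT (mulT (1, 0, 0))) = g (mulT (mulT (1, 0, 0)))) : f = g := by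
  have e1 : mulT (1, 0, 0) = (0, 1, 0) := by decide
  have e2 : mulT (mulT (1, 0, 0)) = (0, 0, 1) := by decide
  rw [e2] at hT2
  rw [e1] at hT
  refine AddMonoidHom.ext fun ⟨a, b, e⟩ => ?_
  have : ((a, b, e) : Cubic) = a.val • (1, 0, 0) + (b.val • (0, 1, 0) + e.val • (0, 0, 1)) := by
    ext <;> simp
  simp only [this, map_add, map_nsmul, h, hT, hT2]

include T hS

/-- If `υ` vanishes, then `G' / G''` is generated by the conjugates of `δ`; an action on `Cubic`
shows that they satisfy no further relations. -/
theorem nonempty_equiv_cubic (hυ : T.υ = 0) (ρ : G →* Equiv.Perm Cubic)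
    (hs : ρ s = affS mulT 0) (hc : ρ c = affC (1, 0, 0))
    (hρ : Subgroup.closure
      {g | ρ g = affS mulT 0 ∨ ρ g = affR ∨ ρ g = affC ((1, 0, 0) : Cubic)} = ⊤) :
    Nonempty (Cubic ≃+ DerivedQuot G) := by
  have hT := translationHom_conjAct mulT (1, 0, 0) 0 ρ hρ hs
  have hδ := translationHom_δ mulT (1, 0, 0) 0 ρ hρ T hc
  have hleft : (translationHom mulT (1, 0, 0) 0 ρ hρ).comp T.ofCubic = AddMonoidHom.id _ := by
    apply cubic_hom_ext <;>
    simp only [AddMonoidHom.comp_apply, T.ofCubic_mulT, T.ofCubic_one, hT, hδ,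
      AddMonoidHom.id_apply]
  refine ⟨AddEquiv.ofBijective T.ofCubic ⟨?_, ?_⟩⟩
  · exact Function.LeftInverse.injective (g := translationHom mulT (1, 0, 0) 0 ρ hρ)
      (DFunLike.congr_fun hleft)
  · exact T.surjective_of_equivariant hS mulT _ T.ofCubic_mulT ⟨_, T.ofCubic_one⟩
      (hυ ▸ zero_mem _)

/-- If `G` acts on `Cubic × (ℤ →₀ ℤ)` by affine maps, `s` having the translation part `(0, e₀)`,
then the conjugates of `υ` under the powers of `s` are independent, also of those of `δ`. -/
theorem nonempty_equiv_cubic_prod (ρ : G →* Equiv.Perm (Cubic × (ℤ →₀ ℤ)))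
    (hs : ρ s = affS (mulT.prodCongr shift) (0, Finsupp.single 0 1)) (hr : ρ r = affR)
    (hc : ρ c = affC ((1, 0, 0), 0))
    (hρ : Subgroup.closure {g | ρ g = affS (mulT.prodCongr shift) (0, Finsupp.single 0 1) ∨
      ρ g = affR ∨ ρ g = affC (((1, 0, 0), 0) : Cubic × (ℤ →₀ ℤ))} = ⊤) :
    Nonempty (Cubic × (ℤ →₀ ℤ) ≃+ DerivedQuot G) := by
  have hT := translationHom_conjAct _ _ _ ρ hρ hs
  have hδ := translationHom_δ _ _ _ ρ hρ T hc
  have hυ := translationHom_υ _ _ _ ρ hρ T hs hr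
  have hleft : (translationHom _ _ _ ρ hρ).comp T.ofCubic = AddMonoidHom.inl _ _ := by
    apply cubic_hom_ext <;>
    simp only [AddMonoidHom.comp_apply, T.ofCubic_mulT, T.ofCubic_one, hT, hδ, prodCongr_apply,
      map_zero, AddMonoidHom.inl_apply]
  -- `υ` acts as the translation by `w + w`, whence the factor `2`
  have hright : (translationHom _ _ _ ρ hρ).comp T.ofFree =
      (AddMonoidHom.inr _ _).comp (2 • AddMonoidHom.id _) := by
    refine Finsupp.addHom_ext fun k a => ?_
    have := translationHom_zpow _ _ _ ρ hρ hs k T.υ (fun k => (0, Finsupp.single k 2))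
      (fun k => by rw [prodCongr_apply, map_zero, shift_single]) (by
        rw [hυ]; ext : 1
        · simp
        · change Finsupp.single 0 1 + Finsupp.single 0 1 = Finsupp.single (0 : ℤ) (2 : ℤ)
          rw [← Finsupp.single_add]; rfl)
    rw [AddMonoidHom.comp_apply, T.ofFree_single, map_zsmul, this]
    ext : 1
    · simp
    · simp [mul_comm]
  refine ⟨AddEquiv.ofBijective (T.ofCubic.coprod T.ofFree) ⟨?_, ?_⟩⟩
  · rw [injective_iff_map_eq_zero]
    rintro ⟨x, y⟩ h
    have h := congrArg (translationHom _ _ _ ρ hρ) h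
    have hx := DFunLike.congr_fun hleft x
    have hy := DFunLike.congr_fun hright y
    simp only [AddMonoidHom.comp_apply] at hx hy
    rw [AddMonoidHom.coprod_apply, map_add, hx, hy, map_zero] at h
    have h1 := congrArg Prod.fst h
    have h2 := congrArg Prod.snd h
    simp at h1 h2
    rw [h1, h2]; rfl
  · refine T.surjective_of_equivariant hS (mulT.prodCongr shift) _ ?_
      ⟨((1, 0, 0), 0), by simp [T.ofCubic_one]⟩ ⟨(0, Finsupp.single 0 1), ?_⟩
    · rintro ⟨x, y⟩
      simp [prodCongr_apply, T.ofCubic_mulT, T.ofFree_shift]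
    · simp [T.ofFree_single, conjAct_one]

end Models

/-! ### Relations and homomorphisms of virtual braid groups -/

variable {n : ℕ}

/-- `σ_i` in the virtual braid group. -/
def σ (i : Fin (n - 1)) : VB n := PresentedGroup.of (Gen.sigma i)

/-- `ρ_i` in the virtual braid group. -/
def ρ (i : Fin (n - 1)) : VB n := PresentedGroup.of (Gen.rho i)

lemma ρ_sq (i : Fin (n - 1)) : ρ i * ρ i = 1 := by
  have := PresentedGroup.one_of_mem (rels := {r | Rel n r}) (Rel.rho_sq i)
  rwa [pow_two, map_mul] at this

lemma σ_braid {i j : Fin (n - 1)} (h : (j : ℕ) = (i : ℕ) + 1) :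
    σ i * σ j * σ i = σ j * σ i * σ j := by
  have := PresentedGroup.one_of_mem (rels := {r | Rel n r}) (Rel.sigma_braid i j h)
  rw [map_mul, map_inv] at this
  exact mul_inv_eq_one.1 this

lemma ρ_comm {i j : Fin (n - 1)} (h : Far i j) : ρ i * ρ j = ρ j * ρ i := by
  have := PresentedGroup.one_of_mem (rels := {r | Rel n r}) (Rel.rho_comm i j h)
  rw [map_mul, map_inv] at this
  exact mul_inv_eq_one.1 this

lemma ρ_braid {i j : Fin (n - 1)} (h : (j : ℕ) = (i : ℕ) + 1) :
    ρ i * ρ j * ρ i = ρ j * ρ i * ρ j := by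
  have := PresentedGroup.one_of_mem (rels := {r | Rel n r}) (Rel.rho_braid i j h)
  rw [map_mul, map_inv] at this
  exact mul_inv_eq_one.1 this

lemma σ_ρ_comm {i j : Fin (n - 1)} (h : Far i j) : σ i * ρ j = ρ j * σ i := by
  have := PresentedGroup.one_of_mem (rels := {r | Rel n r}) (Rel.mixed_comm i j h)
  rw [map_mul, map_inv] at this
  exact mul_inv_eq_one.1 this

lemma mixed_braid {i j : Fin (n - 1)} (h : (j : ℕ) = (i : ℕ) + 1) :
    ρ i * ρ j * σ i = σ j * ρ i * ρ j := by
  have := PresentedGroup.one_of_mem (rels := {r | Rel n r}) (Rel.mixed_braid i j h)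
  rw [map_mul, map_inv] at this
  exact mul_inv_eq_one.1 this

/-- All `σ_i` are conjugate under the subgroup generated by the `ρ_i`. -/
theorem eq_top_of_mem (H : Subgroup (VB n)) (i₀ : Fin (n - 1)) (h₀ : (i₀ : ℕ) = 0)
    (hσ : σ i₀ ∈ H) (hρ : ∀ i : Fin (n - 1), ρ i ∈ H) : H = ⊤ := by
  have h : ∀ (k : ℕ) (hk : k < n - 1), σ ⟨k, hk⟩ ∈ H := by
    intro k
    induction k with
    | zero =>
      intro hk
      rwa [show (⟨0, hk⟩ : Fin (n - 1)) = i₀ from Fin.ext h₀.symm]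
    | succ k ih =>
      intro hk
      have hb := mixed_braid (i := ⟨k, by omega⟩) (j := ⟨k + 1, hk⟩) rfl
      rw [mul_assoc (σ _)] at hb
      rw [← mul_inv_eq_of_eq_mul hb]
      exact mul_mem (mul_mem (mul_mem (hρ _) (hρ _)) (ih _)) (inv_mem (mul_mem (hρ _) (hρ _)))
  rw [eq_top_iff, ← PresentedGroup.closure_range_of, Subgroup.closure_le]
  rintro _ ⟨i | i, rfl⟩
  · exact h i i.2
  · exact hρ i

/-- Adjacent generators give a triple: the mixed relation says that `σ_j` is the conjugate of `σ_i`
by `ρ_i ρ_j`. -/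
theorem triple (i j : Fin (n - 1)) (h : (j : ℕ) = (i : ℕ) + 1) :
    Triple (σ i) (ρ i) (ρ i * ρ j) where
  r_sq := ρ_sq i
  c_cube := by
    have h1 := ρ_sq i
    have h2 := ρ_sq j
    have h3 := ρ_braid h
    calc ρ i * ρ j * (ρ i * ρ j) * (ρ i * ρ j) = (ρ i * ρ j * ρ i) * (ρ j * ρ i * ρ j) := by group
      _ = (ρ j * ρ i * ρ j) * (ρ j * ρ i * ρ j) := by rw [h3]
      _ = ρ j * (ρ i * (ρ j * ρ j) * ρ i) * ρ j := by group
      _ = 1 := by rw [h2, mul_one, h1, mul_one, h2]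
  rcr := by
    rw [mul_inv_rev, inv_eq_of_mul_eq_one_left (ρ_sq i), inv_eq_of_mul_eq_one_left (ρ_sq j),
      ← mul_assoc, ρ_sq, one_mul]
  braid := by
    have hb := mixed_braid h
    rw [mul_assoc (σ j)] at hb
    rw [mul_inv_eq_of_eq_mul hb]
    exact σ_braid h

section Lift

variable {P : Type*} [Group P]

/-- The images of the generators under the homomorphism to `P` attached to a triple: generators
whose indices have the same parity have the same image. -/
def genImage (s r c : P) : Gen n → P
  | Gen.sigma i => if (i : ℕ) % 2 = 0 then s else c * s * c⁻¹
  | Gen.rho i => if (i : ℕ) % 2 = 0 then r else r * c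

/-- In degree `4` the far commutativity relations concern indices `0` and `2`, which have the same
image, so they only require that `s` and `r` commute. -/
theorem lift_genImage_eq_one {s r c : P} (T : Triple s r c)
    (hn : n ≤ 3 ∨ n ≤ 4 ∧ s * r = r * s) :
    ∀ x ∈ {x | Rel n x}, FreeGroup.lift (genImage s r c) x = 1 := by
  have hr := T.r_sq
  have hcr : r * c * r = c⁻¹ := T.rcr
  have hr2 : r * c * (r * c) = 1 := by rw [← mul_assoc, hcr, inv_mul_cancel]
  have hrb : r * (r * c) * r = (r * c) * r * (r * c) := by
    have hc : c = c⁻¹ * c⁻¹ := by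
      rw [← mul_inv_rev]; exact eq_inv_of_mul_eq_one_right T.c_cube
    have hcr' : c⁻¹ * r = r * c := by rw [← hcr, mul_assoc, hr, mul_one]
    rw [← mul_assoc r r, hr, one_mul, hcr, ← hcr', ← mul_assoc, ← hc]
  have hm : r * (r * c) * s = (c * s * c⁻¹) * r * (r * c) := by
    have : r * (r * c) = c := by rw [← mul_assoc, hr, one_mul]
    rw [mul_assoc _ r, this]; group
  have hm' : r * c * r * (c * s * c⁻¹) = s * (r * c) * r := by
    rw [mul_assoc s, hcr]; group
  have hfar : ∀ i j : Fin (n - 1), Far i j →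
      (i : ℕ) % 2 = 0 ∧ (j : ℕ) % 2 = 0 ∧ s * r = r * s := by
    intro i j hij
    have := i.2; have := j.2
    unfold Far at hij
    rcases hn with hn | ⟨hn, h⟩
    · omega
    · exact ⟨by omega, by omega, h⟩
  rintro x (⟨i, j, h⟩ | ⟨i, j, h⟩ | ⟨i⟩ | ⟨i, j, h⟩ | ⟨i, j, h⟩ | ⟨i, j, h⟩ | ⟨i, j, h⟩)
  all_goals
    simp only [map_mul, map_inv, map_pow, mul_inv_eq_one, fs, fr, FreeGroup.lift_apply_of, genImage]
  · obtain ⟨hi, hj, -⟩ := hfar i j h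
    simp only [hi, hj, if_true]
  · obtain hi | hi := Nat.mod_two_eq_zero_or_one i
    · simp [h, hi, Nat.add_mod, T.braid]
    · simp [h, hi, Nat.add_mod, T.braid]
  · split_ifs <;> rw [pow_two] <;> assumption
  · obtain ⟨hi, hj, -⟩ := hfar i j h
    simp only [hi, hj, if_true]
  · obtain hi | hi := Nat.mod_two_eq_zero_or_one i
    · simp [h, hi, Nat.add_mod, hrb]
    · simp [h, hi, Nat.add_mod, hrb]
  · obtain ⟨hi, hj, hsr⟩ := hfar i j h
    simp only [hi, hj, if_true, hsr]
  · obtain hi | hi := Nat.mod_two_eq_zero_or_one i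
    · have hj : (j : ℕ) % 2 ≠ 0 := by omega
      simp only [hi, hj, if_true, if_false, hm]
    · have hj : (j : ℕ) % 2 = 0 := by omega
      simp only [hi, hj, if_true, if_false, hm', one_ne_zero]

/-- The homomorphism from the virtual braid group attached to a triple. -/
def liftTriple {s r c : P} (T : Triple s r c) (hn : n ≤ 3 ∨ n ≤ 4 ∧ s * r = r * s) : VB n →* P :=
  PresentedGroup.toGroup (lift_genImage_eq_one T hn)

variable {s r c : P} (T : Triple s r c) (hn : n ≤ 3 ∨ n ≤ 4 ∧ s * r = r * s)

lemma liftTriple_σ (i : Fin (n - 1)) (hi : (i : ℕ) % 2 = 0) : liftTriple T hn (σ i) = s :=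
  (PresentedGroup.toGroup.of _).trans (if_pos hi)

lemma liftTriple_ρ (i : Fin (n - 1)) (hi : (i : ℕ) % 2 = 0) : liftTriple T hn (ρ i) = r :=
  (PresentedGroup.toGroup.of _).trans (if_pos hi)

lemma liftTriple_ρ_mul (i j : Fin (n - 1)) (hi : (i : ℕ) % 2 = 0) (hj : (j : ℕ) % 2 ≠ 0) :
    liftTriple T hn (ρ i * ρ j) = c := by
  have : liftTriple T hn (ρ j) = r * c := (PresentedGroup.toGroup.of _).trans (if_neg hj)
  rw [map_mul, liftTriple_ρ T hn i hi, this, ← mul_assoc, T.r_sq, one_mul]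

lemma closure_liftTriple (hn2 : 3 ≤ n) : Subgroup.closure
    {g | liftTriple T hn g = s ∨ liftTriple T hn g = r ∨ liftTriple T hn g = c} = ⊤ := by
  set H := Subgroup.closure
    {g | liftTriple T hn g = s ∨ liftTriple T hn g = r ∨ liftTriple T hn g = c}
  have hρ : ∀ i : Fin (n - 1), (i : ℕ) % 2 = 0 → ρ i ∈ H := fun i hi =>
    Subgroup.subset_closure (Or.inr (Or.inl (liftTriple_ρ T hn i hi)))
  refine eq_top_of_mem H ⟨0, by omega⟩ rfl
    (Subgroup.subset_closure (Or.inl (liftTriple_σ T hn _ rfl))) fun i => ?_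
  by_cases hi : (i : ℕ) % 2 = 0
  · exact hρ i hi
  · rw [← Subgroup.mul_mem_cancel_left H (hρ ⟨0, by omega⟩ rfl)]
    exact Subgroup.subset_closure (Or.inr (Or.inr (liftTriple_ρ_mul T hn _ i rfl hi)))

end Lift

/-! ### Virtual braid groups modulo the second derived subgroup -/

section SecondDerived

lemma ρ_mul_mem {i j : Fin (n - 1)} (h : (j : ℕ) = (i : ℕ) + 1) : ρ i * ρ j ∈ commutator (VB n) :=
  (triple i j h).c_mem

lemma mk_mul_comm_of_mem {G : Type*} [Group G] {x y : G} (hx : x ∈ commutator G)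
    (hy : y ∈ commutator G) :
    QuotientGroup.mk' (derived₂ G) x * QuotientGroup.mk' (derived₂ G) y =
      QuotientGroup.mk' (derived₂ G) y * QuotientGroup.mk' (derived₂ G) x := by
  rw [← commutatorElement_eq_one_iff_mul_comm, ← map_commutatorElement]
  exact (QuotientGroup.eq_one_iff _).2 (Subgroup.commutator_mem_commutator hx hy)

/-- The alternating group of degree `4` has the Klein four-group as its commutator subgroup;
hence `ρ_i = ρ_{i+2}` modulo the second derived subgroup. -/
lemma mk_ρ_eq {i j k : Fin (n - 1)} (hj : (j : ℕ) = (i : ℕ) + 1) (hk : (k : ℕ) = (j : ℕ) + 1) :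
    QuotientGroup.mk' (derived₂ (VB n)) (ρ i) = QuotientGroup.mk' (derived₂ (VB n)) (ρ k) := by
  set f := QuotientGroup.mk' (derived₂ (VB n))
  have hij := ρ_mul_mem hj
  have hjk := ρ_mul_mem hk
  have hik : ρ i * ρ k ∈ commutator (VB n) := by
    have := mul_mem hij hjk
    rwa [mul_assoc, ← mul_assoc (ρ j), ρ_sq, one_mul] at this
  have e : f _ * f _ = f _ * f _ := mk_mul_comm_of_mem hij hik
  have hci := congrArg f (ρ_comm (i := i) (j := k) (Or.inl (by omega)))
  have hi := congrArg f (ρ_sq i)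
  have hk2 := congrArg f (ρ_sq k)
  have b1 := congrArg f (ρ_braid hj)
  have b2 := congrArg f (ρ_braid hk)
  simp only [map_mul, map_one] at e hci hi hk2 b1 b2
  set a := f (ρ i)
  set b := f (ρ j)
  set d := f (ρ k)
  have h1 : a * b * a = d * b * d := by
    rw [hci, mul_assoc d, ← mul_assoc a a, hi, one_mul, ← hci, ← mul_assoc] at e
    rw [← e, mul_assoc _ d, hk2, mul_one]
  rw [b1, ← b2] at h1
  exact mul_left_cancel (mul_right_cancel h1)

/-- For `n ≥ 5` all `ρ_i` agree modulo the second derived subgroup. -/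
theorem mk_ρ_eq_of_five_le (hn : 5 ≤ n) (i j : Fin (n - 1)) :
    QuotientGroup.mk' (derived₂ (VB n)) (ρ i) = QuotientGroup.mk' (derived₂ (VB n)) (ρ j) := by
  set f := QuotientGroup.mk' (derived₂ (VB n))
  let x : ∀ k, k < n - 1 → Fin (n - 1) := fun k hk => ⟨k, hk⟩
  have h13 : f (ρ (x 1 (by omega))) = f (ρ (x 3 (by omega))) :=
    mk_ρ_eq (j := x 2 (by omega)) rfl rfl
  have h01 : f (ρ (x 1 (by omega))) = f (ρ (x 0 (by omega))) := by
    -- `ρ₁` agrees with `ρ₃`, which commutes with `ρ₀`; commuting braided elements are equal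
    have hc := congrArg f
      (ρ_comm (i := x 0 (by omega)) (j := x 3 (by omega)) (Or.inl (by simp [x])))
    have hb := congrArg f (ρ_braid (i := x 0 (by omega)) (j := x 1 (by omega)) rfl)
    simp only [map_mul] at hc hb
    rw [← h13] at hc
    rw [← hc, mul_assoc, mul_assoc] at hb
    exact (mul_left_cancel (mul_left_cancel hb)).symm
  have h : ∀ k hk, f (ρ (x k hk)) = f (ρ (x 0 (by omega))) := by
    intro k
    induction k using Nat.twoStepInduction with
    | zero => exact fun _ => rfl
    | one => exact fun _ => h01
    | more k ih _ =>
      intro hk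
      rw [← ih (by omega)]
      exact (mk_ρ_eq (i := x k (by omega)) (j := x (k + 1) (by omega)) rfl rfl).symm
  exact (h i i.2).trans (h j j.2).symm

/-- Modulo the second derived subgroup the group is generated by `σ₀` and the common value of the
`ρ_i`, and these commute since `σ₀` commutes with `ρ₂`. -/
theorem commutator_le_derived₂ (hn : 5 ≤ n) : commutator (VB n) ≤ derived₂ (VB n) := by
  let i₀ : Fin (n - 1) := ⟨0, by omega⟩
  let i₂ : Fin (n - 1) := ⟨2, by omega⟩
  have hS : Subgroup.closure ({σ i₀} ∪ Set.range ρ) = (⊤ : Subgroup (VB n)) :=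
    eq_top_of_mem _ i₀ rfl (Subgroup.subset_closure (Or.inl rfl))
      fun i => Subgroup.subset_closure (Or.inr ⟨i, rfl⟩)
  have hmem : ∀ x y : VB n, ⁅x, y⁆ ∈ derived₂ (VB n) ↔
      QuotientGroup.mk' (derived₂ (VB n)) x * QuotientGroup.mk' (derived₂ (VB n)) y =
        QuotientGroup.mk' (derived₂ (VB n)) y * QuotientGroup.mk' (derived₂ (VB n)) x := by
    intro x y
    rw [← commutatorElement_eq_one_iff_mul_comm, ← map_commutatorElement]
    exact (QuotientGroup.eq_one_iff _).symm
  have hσρ : ∀ i,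
      QuotientGroup.mk' (derived₂ (VB n)) (σ i₀) * QuotientGroup.mk' (derived₂ (VB n)) (ρ i) =
      QuotientGroup.mk' (derived₂ (VB n)) (ρ i) * QuotientGroup.mk' (derived₂ (VB n)) (σ i₀) := by
    intro i
    rw [mk_ρ_eq_of_five_le hn i i₂, ← map_mul, ← map_mul,
      σ_ρ_comm (i := i₀) (j := i₂) (Or.inl le_rfl)]
  refine commutator_le_of_closure_eq_top hS _ (fun x _ h hh => ⟨?_, ?_⟩) ?_
  · exact Subgroup.Normal.conj_mem inferInstance h hh x
  · simpa using Subgroup.Normal.conj_mem inferInstance h hh x⁻¹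
  · rintro x (rfl | ⟨i, rfl⟩) y (rfl | ⟨j, rfl⟩) <;> rw [hmem]
    · exact hσρ j
    · exact (hσρ i).symm
    · rw [mk_ρ_eq_of_five_le hn i j]

end SecondDerived

/-! ### Three and four strands -/

theorem nonempty_equiv_three : Nonempty (Cubic × (ℤ →₀ ℤ) ≃+ DerivedQuot (VB 3)) := by
  have T := triple (n := 3) 0 1 rfl
  have hS : Subgroup.closure ({σ 0, ρ 0, ρ 0 * ρ 1} ∪
      (derived₂ (VB 3) : Set (VB 3))) = ⊤ := by
    refine eq_top_of_mem _ 0 rfl (Subgroup.subset_closure (by simp)) fun i => ?_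
    have h0 : ρ 0 ∈ Subgroup.closure ({σ 0, ρ 0, ρ 0 * ρ 1} ∪
      (derived₂ (VB 3) : Set (VB 3))) :=
      Subgroup.subset_closure (by simp)
    fin_cases i
    · exact h0
    · refine (Subgroup.mul_mem_cancel_left _ h0).1 (Subgroup.subset_closure ?_)
      simp
  have T' : Triple (affS (mulT.prodCongr shift) (0, Finsupp.single 0 1)) affR
      (affC (((1, 0, 0), 0) : Cubic × (ℤ →₀ ℤ))) :=
    affine_triple _ _ _ (Prod.ext (by decide) (by simp))
      (Prod.ext (by simp only [prodCongr_apply]; decide) (by simp [prodCongr_apply]))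
  have hn : 3 ≤ 3 ∨ 3 ≤ 4 ∧ affS (mulT.prodCongr shift) ((0 : Cubic), Finsupp.single 0 1) * affR =
      affR * affS (mulT.prodCongr shift) (0, Finsupp.single 0 1) := Or.inl le_rfl
  exact nonempty_equiv_cubic_prod T hS (liftTriple T' hn) (liftTriple_σ T' hn _ rfl)
    (liftTriple_ρ T' hn _ rfl) (liftTriple_ρ_mul T' hn _ _ rfl (by decide))
    (closure_liftTriple T' hn le_rfl)

theorem nonempty_equiv_four : Nonempty (Cubic ≃+ DerivedQuot (VB 4)) := by
  have T := triple (n := 4) 0 1 rfl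
  have h02 := mk_ρ_eq (n := 4) (i := 0) (j := 1) (k := 2) rfl rfl
  have hS : Subgroup.closure ({σ 0, ρ 0, ρ 0 * ρ 1} ∪ (derived₂ (VB 4) : Set (VB 4))) = ⊤ := by
    refine eq_top_of_mem _ 0 rfl (Subgroup.subset_closure (by simp)) fun i => ?_
    have h0 : ρ 0 ∈ Subgroup.closure ({σ 0, ρ 0, ρ 0 * ρ 1} ∪ (derived₂ (VB 4) : Set (VB 4))) :=
      Subgroup.subset_closure (by simp)
    fin_cases i
    · exact h0
    · refine (Subgroup.mul_mem_cancel_left _ h0).1 (Subgroup.subset_closure ?_)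
      simp
    · refine (Subgroup.mul_mem_cancel_left _ (inv_mem h0)).1
        (Subgroup.subset_closure (Or.inr ?_))
      exact QuotientGroup.eq.1 h02
  -- `ρ₀` agrees modulo the second derived subgroup with `ρ₂`, which commutes with `σ₀`
  have hυ : T.υ = 0 := by
    rw [Triple.υ, cls_eq_zero]
    rw [← QuotientGroup.eq_one_iff, ← QuotientGroup.mk'_apply, map_mul, map_mul, map_mul, h02,
      ← map_mul, σ_ρ_comm (n := 4) (i := 0) (j := 2) (Or.inl le_rfl), map_mul, map_inv,
      mul_inv_cancel_right, ← map_mul, ρ_sq, map_one]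
  have T' : Triple (affS mulT 0) affR (affC ((1, 0, 0) : Cubic)) :=
    affine_triple _ _ _ (by decide) (by decide)
  have hn : 4 ≤ 3 ∨ 4 ≤ 4 ∧ affS mulT 0 * affR = affR * affS mulT 0 := by
    refine Or.inr ⟨le_rfl, Equiv.ext fun m => ?_⟩
    simp [affS_apply, affR_apply]
  exact nonempty_equiv_cubic T hS hυ (liftTriple T' hn) (liftTriple_σ T' hn _ rfl)
    (liftTriple_ρ_mul T' hn _ _ rfl (by decide)) (closure_liftTriple T' hn (by norm_num))

end VirtualBraid

theorem corollary1p2 :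
    Nonempty (Abelianization (commutator (VirtualBraid.VB 3)) ≃*
      Multiplicative (ZMod 3 × ZMod 3 × ZMod 3 × (ℕ →₀ ℤ))) ∧
    Nonempty (Abelianization (commutator (VirtualBraid.VB 4)) ≃*
      Multiplicative (ZMod 3 × ZMod 3 × ZMod 3)) ∧
    ∀ n : ℕ, 5 ≤ n →
      Group.IsPerfect (commutator (VirtualBraid.VB n)) ∧
      commutator (VirtualBraid.VB n) =
        ⁅commutator (VirtualBraid.VB n), commutator (VirtualBraid.VB n)⁆ := by
  refine ⟨?_, ?_, fun n hn => ?_⟩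
  · obtain ⟨e⟩ := VirtualBraid.nonempty_equiv_three
    let e' : VirtualBraid.Cubic × (ℤ →₀ ℤ) ≃+ ZMod 3 × ZMod 3 × ZMod 3 × (ℕ →₀ ℤ) :=
      (AddEquiv.prodCongr (AddEquiv.refl _) (Finsupp.domCongr Equiv.intEquivNat)).trans
        (AddEquiv.prodAssoc.trans ((AddEquiv.refl _).prodCongr AddEquiv.prodAssoc))
    exact ⟨AddEquiv.toMultiplicativeRight (e.symm.trans e')⟩
  · obtain ⟨e⟩ := VirtualBraid.nonempty_equiv_four
    exact ⟨AddEquiv.toMultiplicativeRight e.symm⟩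
  · have h := le_antisymm (VirtualBraid.commutator_le_derived₂ hn) (Subgroup.commutator_le_self _)
    exact ⟨Subgroup.isPerfect_iff.2 h.symm, h⟩
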